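/- For positive integers $s_1,\dots,s_l$ ($l\ge 1$) and signs $x_1,\dots,x_l\in\{1,-1\}$ with $(s_1,x_1)\ne(1,1)$, the Euler sum of weight $s_1+\cdots+s_l$ is $$\zeta(s_1,\dots,s_l;x_1,\dots,x_l)=\sum_{k_1>\cdots>k_l>0}\ \prod_{j=1}^l\frac{x_j^{k_j}}{k_j^{s_j}}:=\lim_{N\to\infty}\ \sum_{N>k_1>\cdots>k_l>0}\ \prod_{j=1}^l\frac{x_j^{k_j}}{k_j^{s_j}} .$$ Write $\zeta(s_1,\dots,s_l)$ for it, with a bar over $s_j$ exactly when $x_j=-1$. Every Euler sum of weight three converges and is a $\mathbb{Z}$-linear combination of $\zeta(\bar2,1)$, $\zeta(\bar1,1,1)$ and $\zeta(\bar1,2)$. Explicitly, $$\begin{aligned} \zeta(3)&=8\zeta(\bar2,1),\\ \zeta(\bar3)&=-6\zeta(\bar2,1),\\ \zeta(2,1)&=8\zeta(\bar2,1),\\ \zeta(2,\bar1)&=2\zeta(\bar2,1)-3\zeta(\bar1,2),\\ \zeta(\bar2,\bar1)&=3\zeta(\bar1,2)-7\zeta(\bar2,1),\\ \zeta(\bar1,\bar2)&=-2\zeta(\bar1,2)+\zeta(\bar2,1),\\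 \zeta(\bar1,1,\bar1)&=\zeta(\bar2,1)+\zeta(\bar1,1,1),\\ \zeta(\bar1,\bar1,1)&=\zeta(\bar1,2)-5\zeta(\bar2,1)+\zeta(\bar1,1,1),\\ \zeta(\bar1,\bar1,\bar1)&=\zeta(\bar1,2)+\zeta(\bar1,1,1). \end{aligned}$$ -/

import Mathlib

open Filter Topology

/-- A signed positive integer `(s, x)`: the exponent `s ≥ 1` together with the sign
`x ∈ {1, -1}`. -/
abbrev SignedInt : Type := ℕ+ × ℤˣ

/-- The unbarred entry `s`, that is, exponent `s` with sign `x = 1`. -/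
def unbarred (s : ℕ+) : SignedInt := (s, 1)

/-- The barred entry `s̄`, that is, exponent `s` with sign `x = -1`. -/
def barred (s : ℕ+) : SignedInt := (s, -1)

/-- A signed index `(s₁, …, s_l)` with signs `(x₁, …, x_l)`, first entry first. -/
abbrev SignedIndex : Type := List SignedInt

/-- The weight `s₁ + ⋯ + s_l`. -/
def SignedIndex.weight (w : SignedIndex) : ℕ := (w.map fun p => (p.1 : ℕ)).sum

/-- The indices of Euler sums: nonempty signed indices with `(s₁, x₁) ≠ (1, 1)`. -/
def SignedIndex.IsAdmissible (w : SignedIndex) : Prop :=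
  w ≠ [] ∧ w.head? ≠ some (unbarred 1)

/-- The truncated multiple sum
`∑_{N > k₁ > ⋯ > k_l > 0} ∏_j x_j ^ k_j / k_j ^ s_j`,
written as a nested sum, the outermost summation index being `k₁`. -/
noncomputable def eulerPartialSum : SignedIndex → ℕ → ℝ
  | [], _ => 1
  | p :: w, N =>
      ∑ k ∈ Finset.Ioo 0 N,
        ((p.2 : ℤ) : ℝ) ^ k / (k : ℝ) ^ (p.1 : ℕ) * eulerPartialSum w k

/-- The Euler sum `ζ(s₁, …, s_l; x₁, …, x_l)`: the limit of the sums truncated at `k₁ < N`.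
(For `s₁ = 1`, `x₁ = -1` the series converges only conditionally.) -/
noncomputable def eulerSum (w : SignedIndex) : ℝ :=
  limUnder atTop (eulerPartialSum w)

/-! Convergence: truncated sums are O(√N) by induction on depth, so a leading exponent at least 2
gives terms O(k^(-3/2)), while a leading barred 1 gives an alternating series whose coefficients
have bounded variation.

The identities come from multiplying series in two ways. Splitting a product of truncated sums by
the order of the indices gives the stuffle relations (`eulerPartialSum_mul`,
`eulerPartialSum_mul_cons`). Grouping terms by the sum of the indices and using partial fractions
gives the shuffle relations: through Abel summation for products with ζ(1̄)
(`mul_eq_of_tendsto_cauchyProduct`), and through an explicit truncation error for ζ(2;x)ζ(1;y)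
(`triangleError_eq`, `tendsto_triangleError`). The latter also covers the divergent case y = 1.
Together with the depth-one distribution relation, these determine all weight three sums from three
of them by linear elimination. -/

namespace EulerSum

/-- The real number `x` attached to a sign. -/
noncomputable abbrev sgn (x : ℤˣ) : ℝ := ((x : ℤ) : ℝ)

theorem sgn_mul_self (x : ℤˣ) : sgn x * sgn x = 1 := by
  rcases Int.units_eq_one_or x with rfl | rfl <;> simp [sgn]

theorem sgn_pow_mul_self (x : ℤˣ) (n : ℕ) : sgn x ^ n * sgn x ^ n = 1 := by
  rw [← mul_pow, sgn_mul_self, one_pow]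

theorem abs_sgn_pow (x : ℤˣ) (n : ℕ) : |sgn x ^ n| = 1 := by
  rcases Int.units_eq_one_or x with rfl | rfl <;> simp [sgn]

theorem sgn_mul_pow (x y : ℤˣ) (n : ℕ) : sgn (x * y) ^ n = sgn x ^ n * sgn y ^ n := by
  rw [← mul_pow]; simp [sgn]

/-! ### Truncated sums and convergence -/

/-- The summand of a truncated Euler sum. -/
noncomputable def summand (p : SignedInt) (w : SignedIndex) (k : ℕ) : ℝ :=
  sgn p.2 ^ k / (k : ℝ) ^ (p.1 : ℕ) * eulerPartialSum w k

/-- Division by zero yields 0 and exponents are positive, so sums over `Ioo 0 N` may be taken over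
`range N`. -/
theorem summand_zero (p : SignedInt) (w : SignedIndex) : summand p w 0 = 0 := by
  simp [summand]

theorem eulerPartialSum_cons (p : SignedInt) (w : SignedIndex) (N : ℕ) :
    eulerPartialSum (p :: w) N = ∑ k ∈ Finset.Ioo 0 N, summand p w k := rfl

theorem sum_Ioo_zero_eq_sum_range {f : ℕ → ℝ} (h : f 0 = 0) (N : ℕ) :
    ∑ k ∈ Finset.Ioo 0 N, f k = ∑ k ∈ Finset.range N, f k := by
  refine Finset.sum_subset (fun k hk => by simp at hk ⊢; omega) fun k hk hk' => ?_
  have : k = 0 := by simp at hk hk'; omega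
  rw [this, h]

theorem eulerPartialSum_cons_eq_sum_range (p : SignedInt) (w : SignedIndex) (N : ℕ) :
    eulerPartialSum (p :: w) N = ∑ k ∈ Finset.range N, summand p w k :=
  sum_Ioo_zero_eq_sum_range (summand_zero p w) N

@[simp] theorem eulerPartialSum_nil (N : ℕ) : eulerPartialSum [] N = 1 := by
  simp [eulerPartialSum]

@[simp] theorem eulerPartialSum_cons_zero (p : SignedInt) (w : SignedIndex) :
    eulerPartialSum (p :: w) 0 = 0 := by
  simp [eulerPartialSum]

theorem eulerPartialSum_cons_succ (p : SignedInt) (w : SignedIndex) (N : ℕ) :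
    eulerPartialSum (p :: w) (N + 1) = eulerPartialSum (p :: w) N +
      sgn p.2 ^ N / (N : ℝ) ^ (p.1 : ℕ) * eulerPartialSum w N := by
  simp only [eulerPartialSum_cons_eq_sum_range, Finset.sum_range_succ, summand]

theorem abs_summand_le (p : SignedInt) (w : SignedIndex) {k : ℕ} (hk : 0 < k) :
    |summand p w k| ≤ 1 / k * |eulerPartialSum w k| := by
  have hk' : (1 : ℝ) ≤ k := by exact_mod_cast hk
  rw [summand, abs_mul, abs_div, abs_sgn_pow, abs_of_nonneg (by positivity : (0 : ℝ) ≤ k ^ (p.1 : ℕ))]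
  gcongr
  exact le_self_pow₀ hk' p.1.pos.ne'

/-- With s = √N and t = √(N+1), 1 = (t - s)(t + s) and t ≤ 3s give 1 ≤ 4s(t - s). The right side
telescopes when summed over N. -/
theorem one_div_sqrt_le_four_mul_sub {N : ℕ} (hN : 0 < N) :
    1 / √(N : ℝ) ≤ 4 * (√((N + 1 : ℕ) : ℝ) - √(N : ℝ)) := by
  have hN' : (1 : ℝ) ≤ N := by exact_mod_cast hN
  have hs : 1 ≤ √(N : ℝ) := Real.one_le_sqrt.2 hN'
  have hs2 : √(N : ℝ) ^ 2 = N := Real.sq_sqrt (by positivity)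
  have ht2 : √((N + 1 : ℕ) : ℝ) ^ 2 = N + 1 := by
    rw [Real.sq_sqrt (by positivity)]; push_cast; ring
  have hst : √(N : ℝ) ≤ √((N + 1 : ℕ) : ℝ) := Real.sqrt_le_sqrt (by push_cast; linarith)
  rw [div_le_iff₀ (by positivity)]
  generalize √(N : ℝ) = s at *
  generalize √((N + 1 : ℕ) : ℝ) = t at *
  have ht : t ≤ 3 * s := by nlinarith
  nlinarith [mul_nonneg (sub_nonneg.2 hst) (sub_nonneg.2 ht)]

/-- Truncated Euler sums grow at most like a square root. -/
theorem exists_abs_eulerPartialSum_le (w : SignedIndex) :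
    ∃ C : ℝ, 0 ≤ C ∧ ∀ N : ℕ, 0 < N → |eulerPartialSum w N| ≤ C * √N := by
  induction w with
  | nil =>
    refine ⟨1, zero_le_one, fun N hN => ?_⟩
    have : (1 : ℝ) ≤ N := by exact_mod_cast hN
    simpa using this
  | cons p w ih =>
    obtain ⟨C, hC, h⟩ := ih
    refine ⟨4 * C, by positivity, fun N _ => ?_⟩
    induction N with
    | zero => simp
    | succ N IH =>
      rcases Nat.eq_zero_or_pos N with rfl | hN
      · rw [eulerPartialSum_cons_succ]
        simp [hC]
      have hN' : (0 : ℝ) < N := by exact_mod_cast hN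
      have h1 : |eulerPartialSum (p :: w) (N + 1)| ≤ 4 * C * √N + 1 / N * (C * √N) := by
        have : eulerPartialSum (p :: w) (N + 1) = eulerPartialSum (p :: w) N + summand p w N :=
          eulerPartialSum_cons_succ p w N
        rw [this]
        refine (abs_add_le _ _).trans (add_le_add (IH hN) ((abs_summand_le p w hN).trans ?_))
        gcongr
        exact h N hN
      have h2 : 1 / (N : ℝ) * (C * √N) = C * (1 / √(N : ℝ)) := by
        rw [← Real.sqrt_div_self']; ring
      rw [h2] at h1
      nlinarith [mul_le_mul_of_nonneg_left (one_div_sqrt_le_four_mul_sub hN) hC]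

theorem abs_summand_le_rpow {p : SignedInt} (hp : 2 ≤ (p.1 : ℕ)) (w : SignedIndex) :
    ∃ C : ℝ, ∀ k : ℕ, |summand p w k| ≤ C * (√k / (k : ℝ) ^ 2) := by
  obtain ⟨C, hC, h⟩ := exists_abs_eulerPartialSum_le w
  refine ⟨C, fun k => ?_⟩
  rcases Nat.eq_zero_or_pos k with rfl | hk
  · simp [summand_zero]
  have hk' : (1 : ℝ) ≤ k := by exact_mod_cast hk
  rw [summand, abs_mul, abs_div, abs_sgn_pow,
    abs_of_nonneg (by positivity : (0 : ℝ) ≤ k ^ (p.1 : ℕ))]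
  calc 1 / (k : ℝ) ^ (p.1 : ℕ) * |eulerPartialSum w k| ≤ 1 / (k : ℝ) ^ 2 * (C * √k) := by
        gcongr
        exact h k hk
    _ = C * (√k / (k : ℝ) ^ 2) := by ring

theorem summable_sqrt_div_sq : Summable fun k : ℕ => √(k : ℝ) / (k : ℝ) ^ 2 := by
  have h : Summable fun k : ℕ => 1 / (k : ℝ) ^ (3 / 2 : ℝ) :=
    Real.summable_one_div_nat_rpow.2 (by norm_num)
  refine h.congr fun k => ?_
  rcases Nat.eq_zero_or_pos k with rfl | hk
  · simp
  have hk' : (0 : ℝ) < k := by exact_mod_cast hk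
  rw [Real.sqrt_eq_rpow, ← Real.rpow_natCast (k : ℝ) 2, ← Real.rpow_sub hk', one_div,
    ← Real.rpow_neg hk'.le]
  norm_num

/-- An alternating series whose coefficients tend to zero and have bounded variation converges. -/
theorem exists_tendsto_alternating {b : ℕ → ℝ} (hb : Tendsto b atTop (𝓝 0))
    (hs : Summable fun k => |b k - b (k + 1)|) :
    ∃ l, Tendsto (fun N => ∑ k ∈ Finset.range N, (-1) ^ k * b k) atTop (𝓝 l) := by
  have hs' : Summable fun k => (-1 : ℝ) ^ k * (b k - b (k + 1)) := by
    refine Summable.of_abs (hs.congr fun k => ?_)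
    rw [abs_mul, abs_neg_one_pow, one_mul]
  have hb' : Tendsto (fun N => (-1 : ℝ) ^ N * b N) atTop (𝓝 0) := by
    rw [tendsto_zero_iff_abs_tendsto_zero] at hb ⊢
    simpa [Function.comp_def, abs_mul] using hb
  -- Summation by parts: 2 ∑_{k<N} (-1)^k b_k = ∑_{k<N} (-1)^k (b_k - b_{k+1}) + b_0 - (-1)^N b_N.
  refine ⟨_, (((hs'.hasSum.tendsto_sum_nat.add_const (b 0)).sub hb').div_const 2).congr fun N => ?_⟩
  induction N with
  | zero => simp
  | succ N ih =>
    rw [Finset.sum_range_succ, Finset.sum_range_succ, ← ih]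
    ring

theorem exists_abs_eulerPartialSum_succ_sub_le (w : SignedIndex) :
    ∃ C : ℝ, ∀ k : ℕ, 0 < k →
      |eulerPartialSum w (k + 1) - eulerPartialSum w k| ≤ C * (√k / k) := by
  cases w with
  | nil => exact ⟨0, fun k _ => by simp⟩
  | cons p w =>
    obtain ⟨C, hC, h⟩ := exists_abs_eulerPartialSum_le w
    refine ⟨C, fun k hk => ?_⟩
    have : eulerPartialSum (p :: w) (k + 1) - eulerPartialSum (p :: w) k = summand p w k := by
      rw [eulerPartialSum_cons_succ, summand]; ring
    rw [this]
    refine (abs_summand_le p w hk).trans ?_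
    calc 1 / (k : ℝ) * |eulerPartialSum w k| ≤ 1 / k * (C * √k) := by gcongr; exact h k hk
      _ = C * (√k / k) := by ring

/-- Every Euler sum with admissible index converges. -/
theorem tendsto_eulerSum {w : SignedIndex} (hw : w.IsAdmissible) :
    Tendsto (eulerPartialSum w) atTop (𝓝 (eulerSum w)) := by
  refine tendsto_nhds_limUnder ?_
  obtain ⟨hne, hhead⟩ := hw
  obtain _ | ⟨⟨s, x⟩, w⟩ := w
  · exact absurd rfl hne
  simp_rw [funext (eulerPartialSum_cons_eq_sum_range (s, x) w)]
  by_cases hs : 2 ≤ (s : ℕ)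
  · obtain ⟨C, h⟩ := abs_summand_le_rpow (p := (s, x)) hs w
    exact ⟨_, (Summable.of_norm_bounded (summable_sqrt_div_sq.mul_left C) h).hasSum.tendsto_sum_nat⟩
  have hs1 : s = 1 := PNat.eq (by have := s.pos; rw [PNat.one_coe]; omega)
  subst hs1
  have hx : x = -1 := by
    rcases Int.units_eq_one_or x with rfl | rfl
    · simp [unbarred] at hhead
    · rfl
  subst hx
  obtain ⟨C, hC, h⟩ := exists_abs_eulerPartialSum_le w
  obtain ⟨D, hD⟩ := exists_abs_eulerPartialSum_succ_sub_le w
  have hsq : Tendsto (fun k : ℕ => C * (1 / √(k : ℝ))) atTop (𝓝 0) := by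
    have := (Real.tendsto_sqrt_atTop.comp tendsto_natCast_atTop_atTop).const_div_atTop (1 : ℝ)
    simpa using this.const_mul C
  have hzero : Tendsto (fun k : ℕ => eulerPartialSum w k / k) atTop (𝓝 0) := by
    refine squeeze_zero_norm' ?_ hsq
    filter_upwards [eventually_gt_atTop 0] with k hk
    rw [Real.norm_eq_abs, abs_div, Nat.abs_cast, ← Real.sqrt_div_self']
    have := h k hk
    rw [mul_div_assoc']
    gcongr
  have hsum : Summable fun k : ℕ => |eulerPartialSum w k / k -
      eulerPartialSum w (k + 1) / (k + 1 : ℕ)| := by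
    -- The growth bounds need k > 0, so the term k = 0 is dropped; the variation is then
    -- O(k^(-3/2)).
    rw [← summable_nat_add_iff 1]
    refine Summable.of_nonneg_of_le (fun _ => abs_nonneg _) (fun j => ?_)
      ((summable_nat_add_iff 1).2 (summable_sqrt_div_sq.mul_left (C + D)))
    have hk : 0 < j + 1 := j.succ_pos
    generalize j + 1 = k at hk
    have hk' : (0 : ℝ) < k := by exact_mod_cast hk
    have e : eulerPartialSum w k / k - eulerPartialSum w (k + 1) / (k + 1 : ℕ) =
        1 / (k + 1) * (eulerPartialSum w k / k -
          (eulerPartialSum w (k + 1) - eulerPartialSum w k)) := by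
      push_cast; field_simp; ring
    rw [e, abs_mul, abs_of_nonneg (by positivity : (0 : ℝ) ≤ 1 / (k + 1))]
    have h1 : |eulerPartialSum w k / k| ≤ C * (√k / k) := by
      rw [abs_div, Nat.abs_cast, mul_div_assoc']
      gcongr
      exact h k hk
    have h2 := (abs_sub _ _).trans (add_le_add h1 (hD k hk))
    calc _ ≤ 1 / (k : ℝ) * (C * (√k / k) + D * (√k / k)) := by
          gcongr
          linarith
      _ = (C + D) * (√k / (k : ℝ) ^ 2) := by ring
  obtain ⟨l, hl⟩ := exists_tendsto_alternating (b := fun k => eulerPartialSum w k / k) hzero hsum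
  refine ⟨l, hl.congr fun N => Finset.sum_congr rfl fun k _ => ?_⟩
  simp [summand, sgn]
  ring

/-! ### Truncated double shuffle for ζ(2;x)ζ(1;y) -/

theorem sum_Ioo_reflect (f : ℕ → ℕ → ℝ) (N : ℕ) :
    ∑ k ∈ Finset.Ioo 0 N, f k (N - k) = ∑ k ∈ Finset.Ioo 0 N, f (N - k) k := by
  refine Finset.sum_nbij' (N - ·) (N - ·) ?_ ?_ ?_ ?_ ?_
  · intro k hk; simp at hk ⊢; omega
  · intro k hk; simp at hk ⊢; omega
  · intro k hk; simp at hk ⊢; omega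
  · intro k hk; simp at hk ⊢; omega
  · intro k hk
    simp at hk
    rw [show N - (N - k) = k by omega]

theorem sum_Ioo_zero_succ (f : ℕ → ℝ) {N : ℕ} (hN : 0 < N) :
    ∑ k ∈ Finset.Ioo 0 (N + 1), f k = ∑ k ∈ Finset.Ioo 0 N, f k + f N := by
  rw [Finset.Ioo_add_one_right_eq_Ioc, ← Finset.Ioo_insert_right hN, Finset.sum_insert (by simp),
    add_comm]

theorem eulerPartialSum_single (p : SignedInt) (N : ℕ) :
    eulerPartialSum [p] N = ∑ k ∈ Finset.Ioo 0 N, sgn p.2 ^ k / (k : ℝ) ^ (p.1 : ℕ) := by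
  simp [eulerPartialSum_cons, summand]

/-- The discrepancy between `(∑_{m < N} x^m / m²) (∑_{n < N} y^n / n)` and the sum of the same
terms over the triangle `m + n < N`. -/
noncomputable def triangleError (x y : ℤˣ) (N : ℕ) : ℝ :=
  ∑ m ∈ Finset.Ioo 0 N, sgn x ^ m / (m : ℝ) ^ 2 *
    (eulerPartialSum [(1, y)] N - eulerPartialSum [(1, y)] (N - m))

/-- Partial fractions: 1/(m²(N-m)) = 1/(N m²) + 1/(N² m) + 1/(N²(N-m)), the last piece being
reflected by m ↦ N - m. Signs combine since x^m y^(N-m) = y^N (xy)^m. -/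
theorem sum_sgn_div_sq_mul_sub (x y : ℤˣ) {N : ℕ} (hN : 0 < N) :
    ∑ m ∈ Finset.Ioo 0 N, sgn x ^ m / (m : ℝ) ^ 2 * (sgn y ^ (N - m) / ((N - m : ℕ) : ℝ)) =
      sgn y ^ N / N * eulerPartialSum [(2, x * y)] N +
      sgn y ^ N / (N : ℝ) ^ 2 * eulerPartialSum [(1, x * y)] N +
      sgn x ^ N / (N : ℝ) ^ 2 * eulerPartialSum [(1, x * y)] N := by
  have hN' : (0 : ℝ) < N := by exact_mod_cast hN
  have hy : ∀ z t : ℤˣ, ∀ m ∈ Finset.Ioo 0 N, sgn z ^ N * sgn (t * z) ^ m =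
      sgn t ^ m * sgn z ^ (N - m) := by
    intro z t m hm
    simp at hm
    rw [sgn_mul_pow, ← Nat.sub_add_cancel hm.2.le, pow_add, Nat.sub_add_cancel hm.2.le]
    linear_combination (sgn z ^ (N - m) * sgn t ^ m) * sgn_pow_mul_self z m
  have h3 : sgn x ^ N / (N : ℝ) ^ 2 * eulerPartialSum [(1, x * y)] N =
      ∑ m ∈ Finset.Ioo 0 N, 1 / (N : ℝ) ^ 2 * (sgn x ^ m * sgn y ^ (N - m)) / (N - m : ℕ) := by
    have := sum_Ioo_reflect (fun i j => 1 / (N : ℝ) ^ 2 * (sgn x ^ i * sgn y ^ j) / (j : ℕ)) N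
    rw [this, eulerPartialSum_single, Finset.mul_sum]
    refine Finset.sum_congr rfl fun m hm => ?_
    have := hy x y m hm
    rw [mul_comm y x] at this
    rw [mul_comm (sgn x ^ (N - m)), ← this]
    simp
    ring
  rw [h3, eulerPartialSum_single, eulerPartialSum_single, Finset.mul_sum, Finset.mul_sum,
    ← Finset.sum_add_distrib, ← Finset.sum_add_distrib]
  refine Finset.sum_congr rfl fun m hm => ?_
  have e := hy y x m hm
  simp at hm
  have hm' : (0 : ℝ) < m := by exact_mod_cast hm.1
  have hNm : (0 : ℝ) < N - m := sub_pos.2 (by exact_mod_cast hm.2)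
  rw [div_mul_div_comm (sgn y ^ N), div_mul_div_comm (sgn y ^ N), e, Nat.cast_sub hm.2.le]
  simp
  field_simp
  ring

/-- The first three terms are the stuffle expansion of the full product; the last three are the
shuffle expansion of the triangle m + n < N. The proof compares increments in N: the diagonal m + n
= N contributes the partial-fraction sum. -/
theorem triangleError_eq (x y : ℤˣ) (N : ℕ) :
    triangleError x y N = eulerPartialSum [(2, x), (1, y)] N + eulerPartialSum [(3, x * y)] N +
      eulerPartialSum [(1, y), (2, x)] N - eulerPartialSum [(1, y), (2, x * y)] N -
      eulerPartialSum [(2, y), (1, x * y)] N - eulerPartialSum [(2, x), (1, x * y)] N := by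
  induction N with
  | zero => simp [triangleError]
  | succ N ih =>
    rcases Nat.eq_zero_or_pos N with rfl | hN
    · simp [triangleError, eulerPartialSum_cons_succ, show Finset.Ioo 0 1 = ∅ from rfl]
    have hN' : (0 : ℝ) < N := by exact_mod_cast hN
    have h1 : triangleError x y (N + 1) = triangleError x y N +
        sgn y ^ N / N * eulerPartialSum [(2, x)] N -
        ∑ m ∈ Finset.Ioo 0 N, sgn x ^ m / (m : ℝ) ^ 2 *
          (sgn y ^ (N - m) / ((N - m : ℕ) : ℝ)) +
        sgn x ^ N / (N : ℝ) ^ 2 * (eulerPartialSum [(1, y)] N + sgn y ^ N / N) := by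
      rw [triangleError, sum_Ioo_zero_succ _ hN, triangleError, eulerPartialSum_single (2, x),
        Finset.mul_sum, ← Finset.sum_add_distrib, ← Finset.sum_sub_distrib]
      congr 1
      · refine Finset.sum_congr rfl fun m hm => ?_
        simp only [Finset.mem_Ioo] at hm
        rw [Nat.sub_add_comm hm.2.le, eulerPartialSum_cons_succ, eulerPartialSum_cons_succ]
        simp
        ring
      · simp [eulerPartialSum_cons_succ]
    rw [h1, ih, sum_sgn_div_sq_mul_sub x y hN]
    simp only [eulerPartialSum_cons_succ, eulerPartialSum_nil, sgn_mul_pow]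
    simp
    field_simp
    ring

theorem abs_eulerPartialSum_add_sub_le (y : ℤˣ) {M : ℕ} (hM : 0 < M) (m : ℕ) :
    |eulerPartialSum [(1, y)] (M + m) - eulerPartialSum [(1, y)] M| ≤ m / M := by
  have hM' : (0 : ℝ) < M := by exact_mod_cast hM
  induction m with
  | zero => simp
  | succ m ih =>
    rw [← add_assoc, eulerPartialSum_cons_succ]
    have : |sgn y ^ (M + m) / ((M + m : ℕ) : ℝ) ^ ((1 : ℕ+) : ℕ)| ≤ 1 / M := by
      rw [abs_div, abs_sgn_pow]
      simp
      rw [abs_of_nonneg (by positivity)]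
      gcongr
      simp
    calc _ ≤ |eulerPartialSum [(1, y)] (M + m) - eulerPartialSum [(1, y)] M| +
          |sgn y ^ (M + m) / ((M + m : ℕ) : ℝ) ^ ((1 : ℕ+) : ℕ)| := by
          refine le_trans (le_of_eq ?_) (abs_add_le _ _)
          simp
          ring_nf
      _ ≤ m / M + 1 / M := add_le_add ih this
      _ = _ := by push_cast; ring

theorem tendsto_triangleError (x y : ℤˣ) : Tendsto (triangleError x y) atTop (𝓝 0) := by
  obtain ⟨C, hC, h⟩ := exists_abs_eulerPartialSum_le [((1 : ℕ+), (1 : ℤˣ))]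
  have hsq : Tendsto (fun k : ℕ => 2 * C * (1 / √(k : ℝ))) atTop (𝓝 0) := by
    have := (Real.tendsto_sqrt_atTop.comp tendsto_natCast_atTop_atTop).const_div_atTop (1 : ℝ)
    simpa using this.const_mul (2 * C)
  refine squeeze_zero_norm' ?_ hsq
  filter_upwards [eventually_gt_atTop 0] with N hN
  have hN' : (0 : ℝ) < N := by exact_mod_cast hN
  have hH : eulerPartialSum [((1 : ℕ+), (1 : ℤˣ))] N = ∑ m ∈ Finset.Ioo 0 N, 1 / (m : ℝ) := by
    rw [eulerPartialSum_single]; simp [sgn]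
  -- Each term is at most (1/m²) · m/(N-m) = (1/N)(1/m + 1/(N-m)), so the total is at most twice a
  -- harmonic sum over N.
  calc |triangleError x y N| ≤ ∑ m ∈ Finset.Ioo 0 N, (1 / (N : ℝ) * (1 / m) +
        1 / N * (1 / (N - m : ℕ))) := by
        refine (Finset.abs_sum_le_sum_abs _ _).trans (Finset.sum_le_sum fun m hm => ?_)
        simp only [Finset.mem_Ioo] at hm
        have hm' : (0 : ℝ) < m := by exact_mod_cast hm.1
        have hNm : (0 : ℝ) < N - m := sub_pos.2 (by exact_mod_cast hm.2)
        have h1 := abs_eulerPartialSum_add_sub_le y (Nat.sub_pos_of_lt hm.2) m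
        rw [Nat.sub_add_cancel hm.2.le] at h1
        rw [abs_mul, abs_div, abs_sgn_pow, abs_of_nonneg (by positivity : (0 : ℝ) ≤ (m : ℝ) ^ 2)]
        refine (mul_le_mul_of_nonneg_left h1 (by positivity)).trans (le_of_eq ?_)
        rw [Nat.cast_sub hm.2.le]
        field_simp
        ring
    _ = 2 * (1 / N * eulerPartialSum [((1 : ℕ+), (1 : ℤˣ))] N) := by
        rw [Finset.sum_add_distrib, sum_Ioo_reflect (fun _ j => 1 / (N : ℝ) * (1 / (j : ℕ))),
          ← Finset.mul_sum, hH]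
        ring
    _ ≤ 2 * (1 / N * (C * √N)) := by
        gcongr
        exact (le_abs_self _).trans (h N hN)
    _ = 2 * C * (1 / √N) := by rw [← Real.sqrt_div_self']; ring

/-! ### Shuffle products with ζ(1̄) by Abel summation -/

/-- If two series and their Cauchy product converge, then the Cauchy product has the product of
the two sums as its sum. -/
theorem mul_eq_of_tendsto_cauchyProduct {u v c : ℕ → ℝ} {U V W : ℝ}
    (hu : Tendsto (fun N => ∑ k ∈ Finset.range N, u k) atTop (𝓝 U))
    (hv : Tendsto (fun N => ∑ k ∈ Finset.range N, v k) atTop (𝓝 V))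
    (hc : Tendsto (fun N => ∑ k ∈ Finset.range N, c k) atTop (𝓝 W))
    (h : ∀ n, ∑ ij ∈ Finset.HasAntidiagonal.antidiagonal n, u ij.1 * v ij.2 = c n) : U * V = W := by
  have summable_norm {f : ℕ → ℝ} {F : ℝ}
      (hf : Tendsto (fun N => ∑ k ∈ Finset.range N, f k) atTop (𝓝 F)) {t : ℝ} (h0 : 0 < t)
      (h1 : t < 1) : Summable fun n => ‖f n * t ^ n‖ := by
    -- Terms of a convergent series are bounded, so the power series converges absolutely for 0 < t
    -- < 1.
    have hf0 : Tendsto f atTop (𝓝 0) := by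
      have := (hf.comp (tendsto_add_atTop_nat 1)).sub hf
      simpa [Function.comp_def, Finset.sum_range_succ] using this
    obtain ⟨C, hC⟩ := hf0.norm.bddAbove_range
    refine Summable.of_nonneg_of_le (fun _ => norm_nonneg _) (fun n => ?_)
      ((summable_geometric_of_lt_one h0.le h1).mul_left C)
    rw [norm_mul, norm_pow, Real.norm_of_nonneg h0.le]
    gcongr
    exact hC ⟨n, rfl⟩
  -- Abel's limit theorem as t → 1⁻ replaces absolute convergence at t = 1, which fails for ζ(1̄).
  have lim := (Real.tendsto_tsum_powerSeries_nhdsWithin_lt hu).mul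
    (Real.tendsto_tsum_powerSeries_nhdsWithin_lt hv)
  refine tendsto_nhds_unique lim ((Real.tendsto_tsum_powerSeries_nhdsWithin_lt hc).congr' ?_)
  filter_upwards [Ioo_mem_nhdsLT (zero_lt_one (α := ℝ))] with t ht
  rw [tsum_mul_tsum_eq_tsum_sum_antidiagonal_of_summable_norm (summable_norm hu ht.1 ht.2)
    (summable_norm hv ht.1 ht.2)]
  refine tsum_congr fun n => ?_
  rw [← h, Finset.sum_mul]
  refine Finset.sum_congr rfl fun ij hij => ?_
  rw [← Finset.HasAntidiagonal.mem_antidiagonal.1 hij, pow_add]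
  ring

theorem tendsto_sum_summand {p : SignedInt} {w : SignedIndex}
    (h : SignedIndex.IsAdmissible (p :: w)) :
    Tendsto (fun N => ∑ k ∈ Finset.range N, summand p w k) atTop (𝓝 (eulerSum (p :: w))) :=
  (tendsto_eulerSum h).congr (eulerPartialSum_cons_eq_sum_range p w)

theorem isAdmissible_cons {s : ℕ+} {x : ℤˣ} (h : s ≠ 1 ∨ x ≠ 1) (w : SignedIndex) :
    SignedIndex.IsAdmissible ((s, x) :: w) := by
  refine ⟨by simp, ?_⟩
  simp only [List.head?_cons, unbarred, ne_eq, Option.some.injEq, Prod.mk.injEq]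
  tauto

theorem isAdmissible_bar_one (w : SignedIndex) :
    SignedIndex.IsAdmissible ((1, -1) :: w) :=
  isAdmissible_cons (Or.inr (by decide)) w

/-- On the antidiagonal the two signs multiply to (-1)^N, and 1/(n(N-n)) = (1/N)(1/n + 1/(N-n)). -/
theorem sum_antidiagonal_summand (w : SignedIndex) (N : ℕ) :
    ∑ ij ∈ Finset.HasAntidiagonal.antidiagonal N, summand (1, -1) [] ij.1 * summand (1, -1) w ij.2 =
      (-1) ^ N / N * (eulerPartialSum ((1, 1) :: w) N +
        ∑ n ∈ Finset.Ioo 0 N, eulerPartialSum w n / (N - n : ℕ)) := by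
  rw [Finset.Nat.sum_antidiagonal_eq_sum_range_succ
      (fun i j => summand (1, -1) [] i * summand (1, -1) w j), ← Finset.sum_range_reflect,
    Finset.sum_range_succ, eulerPartialSum_cons, ← Finset.sum_add_distrib, Finset.mul_sum]
  simp only [Nat.succ_eq_add_one, Nat.add_sub_cancel, Nat.sub_self, summand_zero, zero_mul,
    add_zero]
  rw [← sum_Ioo_zero_eq_sum_range (by simp [summand_zero])]
  refine Finset.sum_congr rfl fun n hn => ?_
  simp only [Finset.mem_Ioo] at hn
  have hn' : (0 : ℝ) < n := by exact_mod_cast hn.1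
  have hNn : (0 : ℝ) < N - n := sub_pos.2 (by exact_mod_cast hn.2)
  have hN : (0 : ℝ) < N := by linarith
  rw [show N - (N - n) = n by omega]
  have e : (-1 : ℝ) ^ N = (-1) ^ (N - n) * (-1) ^ n := by
    rw [← pow_add, Nat.sub_add_cancel hn.2.le]
  simp [summand, sgn, e, Nat.cast_sub hn.2.le]
  field_simp
  ring

theorem sum_sgn_div_mul_sub (x : ℤˣ) (N : ℕ) :
    ∑ n ∈ Finset.Ioo 0 N, sgn x ^ n / n / (N - n : ℕ) =
      (1 + sgn x ^ N) / N * eulerPartialSum [(1, x)] N := by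
  have h : sgn x ^ N * eulerPartialSum [(1, x)] N =
      ∑ n ∈ Finset.Ioo 0 N, sgn x ^ n / (N - n : ℕ) := by
    rw [sum_Ioo_reflect (fun i j => sgn x ^ i / (j : ℕ)), eulerPartialSum_single, Finset.mul_sum]
    refine Finset.sum_congr rfl fun n hn => ?_
    simp only [Finset.mem_Ioo] at hn
    rw [← Nat.sub_add_cancel hn.2.le, pow_add, Nat.sub_add_cancel hn.2.le]
    simp
    linear_combination (sgn x ^ (N - n) / n) * sgn_pow_mul_self x n
  rw [add_div, add_mul, div_mul_eq_mul_div, div_mul_eq_mul_div, h, eulerPartialSum_single,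
    one_mul, Finset.sum_div, Finset.sum_div, ← Finset.sum_add_distrib]
  refine Finset.sum_congr rfl fun n hn => ?_
  simp only [Finset.mem_Ioo] at hn
  have hn' : (0 : ℝ) < n := by exact_mod_cast hn.1
  have hNn : (0 : ℝ) < N - n := sub_pos.2 (by exact_mod_cast hn.2)
  have hN : (0 : ℝ) < N := by linarith
  simp [Nat.cast_sub hn.2.le]
  field_simp
  ring

/-- Shifting n by one in the sum for N + 1 leaves the sum for N plus ∑ xⁿ/(n(N-n)). By
`sum_sgn_div_mul_sub` this is (1 + x^N)/N times a depth-one sum: the combined increment of the two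
depth-two sums. -/
theorem sum_eulerPartialSum_div_sub (x : ℤˣ) (N : ℕ) :
    ∑ n ∈ Finset.Ioo 0 N, eulerPartialSum [(1, x)] n / (N - n : ℕ) =
      eulerPartialSum [(1, 1), (1, x)] N + eulerPartialSum [(1, x), (1, x)] N := by
  induction N with
  | zero => simp
  | succ N ih =>
    rw [sum_Ioo_zero_eq_sum_range (by simp), Finset.sum_range_succ']
    simp only [eulerPartialSum_cons_zero, zero_div, add_zero, Nat.add_sub_add_right]
    have : ∀ n, eulerPartialSum [(1, x)] (n + 1) / (N - n : ℕ) =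
        eulerPartialSum [(1, x)] n / (N - n : ℕ) + sgn x ^ n / n / (N - n : ℕ) := by
      intro n
      rw [eulerPartialSum_cons_succ]
      simp
      ring
    simp only [this]
    rw [Finset.sum_add_distrib, ← sum_Ioo_zero_eq_sum_range (by simp),
      ← sum_Ioo_zero_eq_sum_range (by simp), ih, sum_sgn_div_mul_sub,
      eulerPartialSum_cons_succ (1, 1), eulerPartialSum_cons_succ (1, x) [(1, x)]]
    simp [sgn]
    ring

theorem bar_one_mul_bar_one_shuffle :
    eulerSum [(1, -1)] * eulerSum [(1, -1)] = 2 * eulerSum [(1, -1), (1, 1)] := by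
  have h := (tendsto_sum_summand (isAdmissible_bar_one [(1, 1)])).const_mul 2
  simp only [Finset.mul_sum] at h
  refine mul_eq_of_tendsto_cauchyProduct (tendsto_sum_summand (isAdmissible_bar_one []))
    (tendsto_sum_summand (isAdmissible_bar_one [])) h fun N => ?_
  rw [sum_antidiagonal_summand]
  simp only [eulerPartialSum_nil]
  rw [sum_Ioo_reflect (fun _ j => 1 / ((j : ℕ) : ℝ))]
  simp [summand, sgn, eulerPartialSum_single]
  ring

theorem bar_one_mul_bar_one_one_shuffle (x : ℤˣ) :
    eulerSum [(1, -1)] * eulerSum [(1, -1), (1, x)] =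
      2 * eulerSum [(1, -1), (1, 1), (1, x)] + eulerSum [(1, -1), (1, x), (1, x)] := by
  have h := ((tendsto_sum_summand (isAdmissible_bar_one [(1, 1), (1, x)])).const_mul 2).add
    (tendsto_sum_summand (isAdmissible_bar_one [(1, x), (1, x)]))
  simp only [Finset.mul_sum, ← Finset.sum_add_distrib] at h
  refine mul_eq_of_tendsto_cauchyProduct (tendsto_sum_summand (isAdmissible_bar_one []))
    (tendsto_sum_summand (isAdmissible_bar_one [(1, x)])) h fun N => ?_
  rw [sum_antidiagonal_summand, sum_eulerPartialSum_div_sub]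
  simp [summand, sgn]
  ring

/-! ### Distribution relation -/

/-- Odd terms cancel and each even term doubles. -/
theorem eulerPartialSum_two_mul (s : ℕ+) (N : ℕ) :
    eulerPartialSum [(s, 1)] (2 * N) + eulerPartialSum [(s, -1)] (2 * N) =
      2 / 2 ^ (s : ℕ) * eulerPartialSum [(s, 1)] N := by
  induction N with
  | zero => simp
  | succ N ih =>
    rw [show 2 * (N + 1) = 2 * N + 1 + 1 by ring]
    simp only [eulerPartialSum_cons_succ, eulerPartialSum_nil]
    rw [mul_add, ← ih]
    simp [sgn, pow_succ, pow_mul, mul_pow]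
    ring

/-- The distribution relation in depth one. -/
theorem eulerSum_add_eulerSum_bar {s : ℕ+} (hs : s ≠ 1) :
    eulerSum [(s, 1)] + eulerSum [(s, -1)] = 2 / 2 ^ (s : ℕ) * eulerSum [(s, 1)] := by
  have h1 := tendsto_eulerSum (isAdmissible_cons (s := s) (x := 1) (Or.inl hs) [])
  have h2 := tendsto_eulerSum (isAdmissible_cons (s := s) (x := -1) (Or.inl hs) [])
  have h2N : Tendsto (fun N : ℕ => 2 * N) atTop atTop :=
    tendsto_id.const_mul_atTop' two_pos
  exact tendsto_nhds_unique ((h1.comp h2N).add (h2.comp h2N))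
    ((h1.const_mul _).congr fun N => (eulerPartialSum_two_mul s N).symm)

/-! ### Stuffle products -/

theorem eulerPartialSum_mul (p q : SignedInt) (N : ℕ) :
    eulerPartialSum [p] N * eulerPartialSum [q] N = eulerPartialSum [p, q] N +
      eulerPartialSum [q, p] N + eulerPartialSum [(p.1 + q.1, p.2 * q.2)] N := by
  induction N with
  | zero => simp
  | succ N ih =>
    simp only [eulerPartialSum_cons_succ, eulerPartialSum_nil, sgn_mul_pow, PNat.add_coe, pow_add]
    rw [add_mul, mul_add, mul_add, ih]
    ring

/-- The index of p lies above, between or below those of q and r, or coincides with one of them. -/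
theorem eulerPartialSum_mul_cons (p q r : SignedInt) (N : ℕ) :
    eulerPartialSum [p] N * eulerPartialSum [q, r] N = eulerPartialSum [p, q, r] N +
      eulerPartialSum [q, p, r] N + eulerPartialSum [q, r, p] N +
      eulerPartialSum [(p.1 + q.1, p.2 * q.2), r] N +
      eulerPartialSum [q, (p.1 + r.1, p.2 * r.2)] N := by
  induction N with
  | zero => simp
  | succ N ih =>
    have h := eulerPartialSum_mul p r N
    rw [eulerPartialSum_cons_succ p [], eulerPartialSum_cons_succ q [r], add_mul, mul_add, mul_add,
      ih]
    simp only [eulerPartialSum_cons_succ _ (_ :: _),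
      eulerPartialSum_nil, sgn_mul_pow, PNat.add_coe, pow_add]
    linear_combination (sgn q.2 ^ N / (N : ℝ) ^ (q.1 : ℕ)) * h

theorem eulerSum_mul {p q : SignedInt} (hp : SignedIndex.IsAdmissible [p])
    (hq : SignedIndex.IsAdmissible [q]) (hpq : SignedIndex.IsAdmissible [p, q])
    (hqp : SignedIndex.IsAdmissible [q, p])
    (h : SignedIndex.IsAdmissible [(p.1 + q.1, p.2 * q.2)]) :
    eulerSum [p] * eulerSum [q] = eulerSum [p, q] + eulerSum [q, p] +
      eulerSum [(p.1 + q.1, p.2 * q.2)] :=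
  tendsto_nhds_unique ((tendsto_eulerSum hp).mul (tendsto_eulerSum hq))
    ((((tendsto_eulerSum hpq).add (tendsto_eulerSum hqp)).add (tendsto_eulerSum h)).congr
      fun N => (eulerPartialSum_mul p q N).symm)

theorem bar_one_mul_stuffle {q : SignedInt} (hq : ∀ w, SignedIndex.IsAdmissible (q :: w)) :
    eulerSum [(1, -1)] * eulerSum [q] = eulerSum [(1, -1), q] + eulerSum [q, (1, -1)] +
      eulerSum [(1 + q.1, -1 * q.2)] :=
  eulerSum_mul (isAdmissible_bar_one _) (hq _) (isAdmissible_bar_one _) (hq _)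
    (isAdmissible_cons (Or.inl (by
      rw [add_comm]; exact (PNat.lt_add_left 1 q.1).ne')) _)

theorem bar_one_mul_bar_one_one_stuffle (x : ℤˣ) :
    eulerSum [(1, -1)] * eulerSum [(1, -1), (1, x)] =
      2 * eulerSum [(1, -1), (1, -1), (1, x)] + eulerSum [(1, -1), (1, x), (1, -1)] +
      eulerSum [(2, 1), (1, x)] + eulerSum [(1, -1), (2, -1 * x)] := by
  have hb := fun w => tendsto_eulerSum (isAdmissible_bar_one w)
  have h2 := tendsto_eulerSum (isAdmissible_cons (s := 2) (x := 1) (Or.inl (by decide)) [(1, x)])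
  refine tendsto_nhds_unique ((hb []).mul (hb [(1, x)]))
    (((((hb [(1, -1), (1, x)]).const_mul 2).add (hb [(1, x), (1, -1)])).add h2).add
      (hb [(2, -1 * x)]) |>.congr fun N => ?_)
  have := eulerPartialSum_mul_cons (1, -1) (1, -1) (1, x) N
  rw [this, ← two_mul]
  rfl

/-! ### Double shuffle relations in the limit -/

/-- The linear relations among double sums obtained by comparing the stuffle product with the
shuffle product. -/
theorem tendsto_double_shuffle (x y : ℤˣ) :
    Tendsto (fun N => eulerPartialSum [(2, x), (1, y)] N + eulerPartialSum [(3, x * y)] N +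
      eulerPartialSum [(1, y), (2, x)] N - eulerPartialSum [(1, y), (2, x * y)] N -
      eulerPartialSum [(2, y), (1, x * y)] N - eulerPartialSum [(2, x), (1, x * y)] N)
      atTop (𝓝 0) :=
  (tendsto_triangleError x y).congr (triangleError_eq x y)

theorem tendsto_two (x : ℤˣ) (w : SignedIndex) :
    Tendsto (eulerPartialSum ((2, x) :: w)) atTop (𝓝 (eulerSum ((2, x) :: w))) :=
  tendsto_eulerSum (isAdmissible_cons (Or.inl (by decide)) w)

theorem tendsto_three (x : ℤˣ) (w : SignedIndex) :
    Tendsto (eulerPartialSum ((3, x) :: w)) atTop (𝓝 (eulerSum ((3, x) :: w))) :=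
  tendsto_eulerSum (isAdmissible_cons (Or.inl (by decide)) w)

/-- For y = 1 the two divergent sums with leading entry 1 are identical and cancel before the limit
is taken. -/
theorem double_shuffle_one (x : ℤˣ) :
    eulerSum [(2, x), (1, 1)] + eulerSum [(3, x)] - eulerSum [(2, 1), (1, x)] -
      eulerSum [(2, x), (1, x)] = 0 := by
  refine tendsto_nhds_unique ((((tendsto_two x _).add (tendsto_three x _)).sub
    (tendsto_two 1 _)).sub (tendsto_two x _)) ((tendsto_double_shuffle x 1).congr fun N => ?_)
  simp only [mul_one]
  ring

theorem double_shuffle_bar_one (x : ℤˣ) :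
    eulerSum [(2, x), (1, -1)] + eulerSum [(3, x * -1)] + eulerSum [(1, -1), (2, x)] -
      eulerSum [(1, -1), (2, x * -1)] - eulerSum [(2, -1), (1, x * -1)] -
      eulerSum [(2, x), (1, x * -1)] = 0 := by
  have hb := fun w => tendsto_eulerSum (isAdmissible_bar_one w)
  exact tendsto_nhds_unique ((((((tendsto_two x _).add (tendsto_three (x * -1) _)).add
    (hb _)).sub (hb _)).sub (tendsto_two (-1) _)).sub (tendsto_two x _))
    (tendsto_double_shuffle x (-1))

/-! ### Elimination in weight three -/

theorem weight_three_relations :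
    eulerSum [(3, 1)] = 8 * eulerSum [(2, -1), (1, 1)] ∧
    eulerSum [(3, -1)] = -6 * eulerSum [(2, -1), (1, 1)] ∧
    eulerSum [(2, 1), (1, 1)] = 8 * eulerSum [(2, -1), (1, 1)] ∧
    eulerSum [(2, 1), (1, -1)] =
      2 * eulerSum [(2, -1), (1, 1)] - 3 * eulerSum [(1, -1), (2, 1)] ∧
    eulerSum [(2, -1), (1, -1)] =
      3 * eulerSum [(1, -1), (2, 1)] - 7 * eulerSum [(2, -1), (1, 1)] ∧
    eulerSum [(1, -1), (2, -1)] =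
      -2 * eulerSum [(1, -1), (2, 1)] + eulerSum [(2, -1), (1, 1)] ∧
    eulerSum [(1, -1), (1, 1), (1, -1)] =
      eulerSum [(2, -1), (1, 1)] + eulerSum [(1, -1), (1, 1), (1, 1)] ∧
    eulerSum [(1, -1), (1, -1), (1, 1)] =
      eulerSum [(1, -1), (2, 1)] - 5 * eulerSum [(2, -1), (1, 1)] +
        eulerSum [(1, -1), (1, 1), (1, 1)] ∧
    eulerSum [(1, -1), (1, -1), (1, -1)] =
      eulerSum [(1, -1), (2, 1)] + eulerSum [(1, -1), (1, 1), (1, 1)] := by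
  have s1 : eulerSum [(1, -1)] * eulerSum [(2, 1)] = eulerSum [(1, -1), (2, 1)] +
      eulerSum [(2, 1), (1, -1)] + eulerSum [(3, -1)] :=
    bar_one_mul_stuffle fun w => isAdmissible_cons (Or.inl (by decide)) w
  have s2 : eulerSum [(1, -1)] * eulerSum [(2, -1)] = eulerSum [(1, -1), (2, -1)] +
      eulerSum [(2, -1), (1, -1)] + eulerSum [(3, 1)] :=
    bar_one_mul_stuffle fun w => isAdmissible_cons (Or.inl (by decide)) w
  have s3 : eulerSum [(1, -1)] * eulerSum [(1, -1)] = eulerSum [(1, -1), (1, -1)] +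
      eulerSum [(1, -1), (1, -1)] + eulerSum [(2, 1)] :=
    bar_one_mul_stuffle isAdmissible_bar_one
  have s4 : eulerSum [(1, -1)] * eulerSum [(1, -1), (1, -1)] =
      2 * eulerSum [(1, -1), (1, -1), (1, -1)] + eulerSum [(1, -1), (1, -1), (1, -1)] +
      eulerSum [(2, 1), (1, -1)] + eulerSum [(1, -1), (2, 1)] :=
    bar_one_mul_bar_one_one_stuffle (-1)
  have s5 : eulerSum [(1, -1)] * eulerSum [(1, -1), (1, 1)] =
      2 * eulerSum [(1, -1), (1, -1), (1, 1)] + eulerSum [(1, -1), (1, 1), (1, -1)] +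
      eulerSum [(2, 1), (1, 1)] + eulerSum [(1, -1), (2, -1)] :=
    bar_one_mul_bar_one_one_stuffle 1
  have c1 := bar_one_mul_bar_one_shuffle
  have c2 := bar_one_mul_bar_one_one_shuffle 1
  have c3 := bar_one_mul_bar_one_one_shuffle (-1)
  have d2 := eulerSum_add_eulerSum_bar (s := 2) (by decide)
  have d3 := eulerSum_add_eulerSum_bar (s := 3) (by decide)
  have t1 := double_shuffle_one 1
  have t2 := double_shuffle_one (-1)
  have t3 : eulerSum [(2, 1), (1, -1)] + eulerSum [(3, -1)] + eulerSum [(1, -1), (2, 1)] -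
      eulerSum [(1, -1), (2, -1)] - eulerSum [(2, -1), (1, -1)] - eulerSum [(2, 1), (1, -1)] = 0 :=
    double_shuffle_bar_one 1
  have t4 : eulerSum [(2, -1), (1, -1)] + eulerSum [(3, 1)] + eulerSum [(1, -1), (2, -1)] -
      eulerSum [(1, -1), (2, 1)] - eulerSum [(2, -1), (1, 1)] - eulerSum [(2, -1), (1, 1)] = 0 :=
    double_shuffle_bar_one (-1)
  norm_num at d2 d3
  have e1 : eulerSum [(2, -1)] = -1 / 2 * eulerSum [(2, 1)] := by linarith
  rw [e1] at s2
  -- Equating stuffle and shuffle for ζ(1̄)² eliminates ζ(1̄,1̄). Every relation needed is then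
  -- linear in the weight three sums and the products ζ(1̄)ζ(2), ζ(1̄)ζ(1̄,1), ζ(1̄)ζ(1̄,1̄),
  -- treated as unknowns.
  have e2 : eulerSum [(1, -1)] * eulerSum [(1, -1), (1, -1)] =
      eulerSum [(1, -1)] * eulerSum [(1, -1), (1, 1)] -
        1 / 2 * (eulerSum [(1, -1)] * eulerSum [(2, 1)]) := by
    have : eulerSum [(1, -1), (1, -1)] =
        eulerSum [(1, -1), (1, 1)] - 1 / 2 * eulerSum [(2, 1)] := by linarith
    rw [this]; ring
  refine ⟨?_, ?_, ?_, ?_, ?_, ?_, ?_, ?_, ?_⟩ <;> linarith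

/-- The signed indices of weight three whose Euler sums are defined. -/
theorem weight_three_cases {w : SignedIndex} (hw : w.IsAdmissible) (h3 : w.weight = 3) :
    (∃ x, w = [(3, x)]) ∨ (∃ x y, w = [(2, x), (1, y)]) ∨ (∃ x, w = [(1, -1), (2, x)]) ∨
      ∃ x y, w = [(1, -1), (1, x), (1, y)] := by
  have eq_of_coe {s t : ℕ+} (h : (s : ℕ) = t) : s = t := PNat.eq h
  have head {x : ℤˣ} {v : SignedIndex} (h : SignedIndex.IsAdmissible ((1, x) :: v)) : x = -1 :=
    (Int.units_eq_one_or x).resolve_left fun hx => h.2 (by rw [hx]; rfl)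
  match w, hw, h3 with
  | [], hw, _ => exact absurd rfl hw.1
  | [(s, x)], _, h3 =>
    simp [SignedIndex.weight] at h3
    exact Or.inl ⟨x, by rw [show s = 3 from eq_of_coe h3]⟩
  | [(s, x), (t, y)], hw, h3 =>
    simp [SignedIndex.weight] at h3
    have hs := s.pos
    have ht := t.pos
    rcases (by omega : (s : ℕ) = 2 ∧ (t : ℕ) = 1 ∨ (s : ℕ) = 1 ∧ (t : ℕ) = 2) with h | h
    · obtain rfl : s = 2 := eq_of_coe h.1
      obtain rfl : t = 1 := eq_of_coe h.2
      exact Or.inr (Or.inl ⟨x, y, rfl⟩)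
    · obtain rfl : s = 1 := eq_of_coe h.1
      obtain rfl : t = 2 := eq_of_coe h.2
      exact Or.inr (Or.inr (Or.inl ⟨y, by rw [head hw]⟩))
  | [(s, x), (t, y), (u, z)], hw, h3 =>
    simp [SignedIndex.weight] at h3
    have hs := s.pos
    have ht := t.pos
    have hu := u.pos
    obtain rfl : s = 1 := eq_of_coe (by rw [PNat.one_coe]; omega)
    obtain rfl : t = 1 := eq_of_coe (by rw [PNat.one_coe]; omega)
    obtain rfl : u = 1 := eq_of_coe (by rw [PNat.one_coe]; omega)
    exact Or.inr (Or.inr (Or.inr ⟨y, z, by rw [head hw]⟩))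
  | p :: q :: r :: s :: v, _, h3 =>
    simp [SignedIndex.weight] at h3
    have := p.1.pos
    have := q.1.pos
    have := r.1.pos
    have := s.1.pos
    omega

end EulerSum

open EulerSum in
theorem proposition3p3 :
    -- every weight three Euler sum converges and is an integral linear combination
    (∀ w : SignedIndex, w.IsAdmissible → w.weight = 3 →
      Tendsto (eulerPartialSum w) atTop (𝓝 (eulerSum w)) ∧
      ∃ m n r : ℤ, eulerSum w =
        m * eulerSum [barred 2, unbarred 1] +
        n * eulerSum [barred 1, unbarred 1, unbarred 1] +
        r * eulerSum [barred 1, unbarred 2]) ∧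
    -- the explicit combinations
    eulerSum [unbarred 3] = 8 * eulerSum [barred 2, unbarred 1] ∧
    eulerSum [barred 3] = -6 * eulerSum [barred 2, unbarred 1] ∧
    eulerSum [unbarred 2, unbarred 1] = 8 * eulerSum [barred 2, unbarred 1] ∧
    eulerSum [unbarred 2, barred 1] =
      2 * eulerSum [barred 2, unbarred 1] - 3 * eulerSum [barred 1, unbarred 2] ∧
    eulerSum [barred 2, barred 1] =
      3 * eulerSum [barred 1, unbarred 2] - 7 * eulerSum [barred 2, unbarred 1] ∧
    eulerSum [barred 1, barred 2] =
      -2 * eulerSum [barred 1, unbarred 2] + eulerSum [barred 2, unbarred 1] ∧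
    eulerSum [barred 1, unbarred 1, barred 1] =
      eulerSum [barred 2, unbarred 1] + eulerSum [barred 1, unbarred 1, unbarred 1] ∧
    eulerSum [barred 1, barred 1, unbarred 1] =
      eulerSum [barred 1, unbarred 2] - 5 * eulerSum [barred 2, unbarred 1] +
        eulerSum [barred 1, unbarred 1, unbarred 1] ∧
    eulerSum [barred 1, barred 1, barred 1] =
      eulerSum [barred 1, unbarred 2] + eulerSum [barred 1, unbarred 1, unbarred 1] := by
  simp only [barred, unbarred]
  have hrel := weight_three_relations
  refine ⟨fun w hw h3 => ⟨tendsto_eulerSum hw, ?_⟩, hrel⟩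
  obtain ⟨r1, r2, r3, r4, r5, r6, r7, r8, r9⟩ := hrel
  -- There are twelve indices: the three generators and the nine with explicit formulas, whose
  -- coefficients are the witnesses.
  rcases weight_three_cases hw h3 with ⟨x, rfl⟩ | ⟨x, y, rfl⟩ | ⟨x, rfl⟩ | ⟨x, y, rfl⟩
  · rcases Int.units_eq_one_or x with rfl | rfl
    · exact ⟨8, 0, 0, by rw [r1]; push_cast; ring⟩
    · exact ⟨-6, 0, 0, by rw [r2]; push_cast; ring⟩
  · rcases Int.units_eq_one_or x with rfl | rfl <;> rcases Int.units_eq_one_or y with rfl | rfl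
    · exact ⟨8, 0, 0, by rw [r3]; push_cast; ring⟩
    · exact ⟨2, 0, -3, by rw [r4]; push_cast; ring⟩
    · exact ⟨1, 0, 0, by push_cast; ring⟩
    · exact ⟨-7, 0, 3, by rw [r5]; push_cast; ring⟩
  · rcases Int.units_eq_one_or x with rfl | rfl
    · exact ⟨0, 0, 1, by push_cast; ring⟩
    · exact ⟨1, 0, -2, by rw [r6]; push_cast; ring⟩
  · rcases Int.units_eq_one_or x with rfl | rfl <;> rcases Int.units_eq_one_or y with rfl | rfl
    · exact ⟨0, 1, 0, by push_cast; ring⟩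
    · exact ⟨1, 1, 0, by rw [r7]; push_cast; ring⟩
    · exact ⟨-5, 1, 1, by rw [r8]; push_cast; ring⟩
    · exact ⟨0, 1, 1, by rw [r9]; push_cast; ring⟩
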